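/- Consider a network with two base stations (BSs) $1,2$, each at the centre of one of two squares. Users arrive according to a Poisson process of rate $\lambda>0$; independently, each user lies in square $1$ with probability $p_1$ and in square $2$ with probability $p_2=1-p_1$, where $p_1\in[0,1]$, and carries a file whose size is exponentially distributed with parameter $\mu>0$. A user in square $k$ has data rate $c_2$ with BS $k$ and data rate $c_1$ with the other BS, where $0<c_1<c_2$. BS $i$ has $m_i\ge 1$ RF chains (an integer): if $X_i>0$ users are associated with BS $i$, each of them whose data rate with BS $i$ is $r$ is served with throughput $\min(m_i,X_i)\,r/X_i$, and it leaves when its file is transmitted. Under the SNR based policy each arriving user associates with the BS with which it has the highest data rate (ties broken at random), and keeps this association. Let $X_{ir}$ be the number of users associated with BS $i$ at data rate $c_r$. Then $(X_{ir})_{i,r\in\{1,2\}}$ is a continuous time Markov chain in which, from a state with $X_i=X_{i1}+X_{i2}$, an arrival at BS $i$ at rate $c_r$ occurs with rate $\lambda$ times the probability that an arriving user associates with BS $i$ at data rate $c_r$, and a departure of such a user occurs with rate $\mu X_{ir}\min(m_i,X_i)c_r/X_i$ (if $X_i>0$). The system is called stable if this chain, started from the empty network and considered on the set of states reachable from it,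 is positive recurrent, i.e. every such state has a finite mean return time. Theorem. Under the SNR based policy, the system is stable if and only if $$\lambda<\mu\,c_2\,\min\left(\frac{m_1}{p_1},\frac{m_2}{p_2}\right),$$ where $m_i/p_i=+\infty$ if $p_i=0$. -/

import Mathlib

open MeasureTheory ProbabilityTheory
open scoped ENNReal

noncomputable section

/-! ## Continuous time Markov chains on a countable state space

A chain is given by its transition rates `q x y` (`x ≠ y`, `q x x = 0`). It is realised through its
jump chain and its holding times: the jump chain `Z` moves from `x` to `y` with probability
`q x y / ν x`, where `ν x = ∑ y, q x y`, and, given `Z`, the holding times are independent,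
the `k`-th one being exponential with rate `ν (Z k)`, that is, `E k / ν (Z k)` for independent
unit exponential variables `E 0, E 1, …` which are also independent of `Z`. -/
namespace CTMC

variable {S : Type*}

/-- Total transition rate out of the state `x`. -/
def totalRate (q : S → S → ℝ≥0∞) (x : S) : ℝ≥0∞ := ∑' y, q x y

open Classical in
/-- Law of the next state of the jump (embedded) chain: `y` has probability `q x y / ν x`.
An absorbing state (`ν x = 0`) is kept for ever; the value at `ν x = ∞` plays no role. -/
def jumpLaw (q : S → S → ℝ≥0∞) (x : S) : PMF S :=
  if h : totalRate q x ≠ 0 ∧ totalRate q x ≠ ∞ then PMF.normalize (q x) h.1 h.2 else PMF.pure x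

/-- `y` can be reached from `x` by finitely many transitions of positive rate. -/
def Reachable (q : S → S → ℝ≥0∞) (x y : S) : Prop :=
  Relation.ReflTransGen (fun a b => 0 < q a b) x y

variable [MeasurableSpace S] [Countable S] [MeasurableSingletonClass S]

/-- Transition kernel of the jump chain. -/
def jumpKernel (q : S → S → ℝ≥0∞) : Kernel S S :=
  Kernel.ofFunOfCountable fun x => (jumpLaw q x).toMeasure

instance jumpKernel_isMarkov (q : S → S → ℝ≥0∞) : IsMarkovKernel (jumpKernel q) :=
  ⟨fun x => PMF.toMeasure.isProbabilityMeasure (jumpLaw q x)⟩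

/-- Law of the jump chain `Z 0, Z 1, …` started at `x`. -/
def jumpChainLaw (q : S → S → ℝ≥0∞) (x : S) : Measure (ℕ → S) :=
  Kernel.trajMeasure (X := fun _ => S) (Measure.dirac x) fun n =>
    (jumpKernel q).comap (fun h : (i : Finset.Iic n) → S => h ⟨n, Finset.mem_Iic.2 le_rfl⟩)
      (measurable_pi_apply _)

/-- Joint law, for the chain started at `x`, of the jump chain `Z` and of an independent sequence
`E` of independent unit exponential variables. -/
def law (q : S → S → ℝ≥0∞) (x : S) : Measure ((ℕ → S) × (ℕ → ℝ)) :=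
  (jumpChainLaw q x).prod (Measure.infinitePi fun _ : ℕ => expMeasure 1)

/-- The time the chain spends in its `k`-th state (`∞` in an absorbing state). -/
def holdingTime (q : S → S → ℝ≥0∞) (ω : (ℕ → S) × (ℕ → ℝ)) (k : ℕ) : ℝ≥0∞ :=
  ENNReal.ofReal (ω.2 k) / totalRate q (ω.1 k)

/-- The time of the `n`-th jump. -/
def jumpTime (q : S → S → ℝ≥0∞) (ω : (ℕ → S) × (ℕ → ℝ)) (n : ℕ) : ℝ≥0∞ :=
  ∑ k ∈ Finset.range n, holdingTime q ω k

/-- The first time, at or after the first jump, at which the chain is in `x`; `∞` if there is no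
such time. -/
def returnTime (q : S → S → ℝ≥0∞) (x : S) (ω : (ℕ → S) × (ℕ → ℝ)) : ℝ≥0∞ :=
  ⨅ (n : ℕ) (_ : 1 ≤ n ∧ ω.1 n = x), jumpTime q ω n

/-- A state is positive recurrent if it is absorbing or if its mean return time, for the chain
started there, is finite (so that, in particular, the chain returns almost surely). -/
def PositiveRecurrentState (q : S → S → ℝ≥0∞) (x : S) : Prop :=
  totalRate q x = 0 ∨ ∫⁻ ω, returnTime q x ω ∂(law q x) < ∞

/-- The chain started at `x₀`, whose state space is the set of states reachable from `x₀`, is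
positive recurrent: all these states are. -/
def PositiveRecurrentFrom (q : S → S → ℝ≥0∞) (x₀ : S) : Prop :=
  ∀ y, Reachable q x₀ y → PositiveRecurrentState q y

end CTMC

/-! ## The network with two base stations -/
namespace TwoBS

/-- Parameters. The base stations are `0` and `1`, and so are the rate classes: class `0` is the
NLoS rate, class `1` the LoS rate. -/
structure Network where
  /-- rate of the Poisson process of arrivals -/
  lam : ℝ
  /-- parameter of the exponential file sizes -/
  mu : ℝ
  /-- the data rates: `c 0` over NLoS links, `c 1` over LoS links -/
  c : Fin 2 → ℝ
  /-- `p k` is the probability that an arriving user is located in the square of `k` -/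
  p : Fin 2 → ℝ
  /-- numbers of RF chains -/
  m : Fin 2 → ℕ

/-- `s i r` is the number of users associated with base station `i` at the rate of class `r`. -/
abbrev State := Fin 2 → Fin 2 → ℕ

/-- One user, associated with base station `i` at the rate of class `r`. -/
def oneUser (i r : Fin 2) : State := Pi.single i (Pi.single r 1)

/-- Class of the link between base station `i` and a user in the square of `k`. -/
def linkClass (k i : Fin 2) : Fin 2 := if i = k then 1 else 0

/-- An association policy: the law of the base station chosen by an arriving user,
given the current state and the rate vector of the user. -/
abbrev Policy := State → (Fin 2 → ℝ) → PMF (Fin 2)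

/-- The base stations from which a user with rate vector `r` gets the highest data rate. -/
def bestRate (r : Fin 2 → ℝ) : Finset (Fin 2) :=
  Finset.univ.filter fun i => ∀ k, r k ≤ r i

theorem bestRate_nonempty (r : Fin 2 → ℝ) : (bestRate r).Nonempty := by
  obtain ⟨i, -, hi⟩ := Finset.exists_max_image Finset.univ r Finset.univ_nonempty
  exact ⟨i, by simpa [bestRate] using fun k => hi k (Finset.mem_univ k)⟩

/-- The SNR based policy: choose a base station of highest data rate, ties broken at random. -/
def snrPolicy : Policy := fun _ r => PMF.uniformOfFinset (bestRate r) (bestRate_nonempty r)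

namespace Network

variable (N : Network)

/-- Rate vector of a user located in the square of `k`. -/
def rateVector (k : Fin 2) : Fin 2 → ℝ := fun i => N.c (linkClass k i)

/-- Probability that a user arriving in state `s` joins base station `i` at the rate of class `r`. -/
def joinProb (π : Policy) (s : State) (i r : Fin 2) : ℝ≥0∞ :=
  ∑ k, if linkClass k i = r then ENNReal.ofReal (N.p k) * π s (N.rateVector k) i else 0

/-- Throughput of each user associated with base station `i` at the rate of class `r`. It is used
only where there is such a user. -/
def throughput (s : State) (i r : Fin 2) : ℝ :=
  min (N.m i : ℝ) (∑ l, s i l : ℕ) * N.c r / (∑ l, s i l : ℕ)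

/-- Transition rates of the chain induced by the policy `π`: arrivals, and departures, each user
leaving at rate `μ` times its throughput. -/
def transitionRate (π : Policy) (s t : State) : ℝ≥0∞ :=
  ∑ i, ∑ r, ((if t = s + oneUser i r then ENNReal.ofReal N.lam * N.joinProb π s i r else 0) +
    (if s = t + oneUser i r then ENNReal.ofReal (N.mu * s i r * N.throughput s i r) else 0))

/-- The network, started empty, is stable under the policy `π`: the induced chain is positive
recurrent. -/
def Stable (π : Policy) : Prop := CTMC.PositiveRecurrentFrom (N.transitionRate π) 0

end Network

end TwoBS

end

/-! Every user joins the base station of its own square at rate c₂, so the stations behave as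
independent M/M/m queues with arrival rates λpᵢ and full service rates μc₂mᵢ. The theorem says that
the chain is positive recurrent exactly when each arrival rate is below the full service rate.

Total transition rates lie between λ and `maxRate`, so a mean return time to `x` is finite exactly
when the mean number of jumps before return is. That number is the sum over k ≥ 0 of the probability
of avoiding `x` at times 1, …, k, which is an iterate of `tabooStep`.

Stability: the product of the M/M/m weights satisfies detailed balance and is summable, and Kac's
inequality `mul_tsum_tabooStep_le` turns its finite mass into finite mean return times.

Instability, including the critical case: if station i satisfies μc₂mᵢ ≤ λpᵢ, its number of users
has nonnegative drift and grows by at most one per jump. From the empty state this forces the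
avoidance probabilities to be at least a constant over n + 1, and the harmonic series diverges
(`not_positiveRecurrentState`). -/

noncomputable section
namespace CTMC

variable {S : Type*}

/-! ### Taboo probabilities of the jump chain -/

/-- The paths that do not visit `x` at the times `1, …, k`. -/
def avoid (x : S) (k : ℕ) : Set (ℕ → S) := {Z | ∀ j, 1 ≤ j → j ≤ k → Z j ≠ x}

theorem avoid_succ (x : S) (k : ℕ) :
    avoid x (k + 1) = avoid x k ∩ {Z | Z (k + 1) ≠ x} := by
  ext Z
  constructor
  · intro h
    exact ⟨fun j h1 h2 => h j h1 (by omega), h (k + 1) (by omega) le_rfl⟩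
  · rintro ⟨h1, h2⟩ j hj hjk
    rcases Nat.lt_or_ge k j with h | h
    · obtain rfl : j = k + 1 := by omega
      exact h2
    · exact h1 j hj h

variable [MeasurableSpace S] [MeasurableSingletonClass S]

theorem measurableSet_avoid (x : S) (k : ℕ) : MeasurableSet (avoid x k) := by
  induction k with
  | zero =>
    convert MeasurableSet.univ using 1
    ext Z
    exact ⟨fun _ => trivial, fun _ j h1 h2 => by omega⟩
  | succ k ih =>
    rw [avoid_succ]
    exact ih.inter ((measurable_pi_apply (X := fun _ => S) (k + 1))
      (measurableSet_singleton x).compl)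

variable [Countable S]

/-- The law of the state after one jump from `y`, killed on `x`, integrated against `f`. -/
def tabooStep (q : S → S → ℝ≥0∞) (x : S) (f : S → ℝ≥0∞) (y : S) : ℝ≥0∞ :=
  ∫⁻ z, ({x}ᶜ : Set S).indicator f z ∂(jumpKernel q y)

instance (q : S → S → ℝ≥0∞) (x : S) : IsProbabilityMeasure (jumpChainLaw q x) := by
  unfold jumpChainLaw
  infer_instance

theorem lintegral_jumpChainLaw_zero (q : S → S → ℝ≥0∞) (x : S) (g : S → ℝ≥0∞) :
    ∫⁻ Z, g (Z 0) ∂(jumpChainLaw q x) = g x := by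
  have hg : Measurable g := measurable_of_countable g
  have hm : Measurable fun Z : ℕ → S => g (Z 0) := hg.comp (measurable_pi_apply 0)
  rw [jumpChainLaw, Kernel.trajMeasure, Measure.map_dirac' (by fun_prop),
    Measure.dirac_bind (by fun_prop), Kernel.lintegral_traj (a := 0) _ hm]
  have h0 : ∀ Z : ℕ → S, Function.updateFinset Z (Finset.Iic 0)
      ((MeasurableEquiv.piUnique fun _ : Finset.Iic 0 => S).symm x) 0 = x := fun Z => by
    simp [Function.updateFinset]
  simp_rw [h0]
  simp

/-- The Markov property at time `k`, with `F` an arbitrary functional of the past. -/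
theorem lintegral_jumpChainLaw_succ (q : S → S → ℝ≥0∞) (x : S) (k : ℕ)
    (F : ((i : Finset.Iic k) → S) → ℝ≥0∞) (hF : Measurable F) (g : S → ℝ≥0∞) :
    ∫⁻ Z, F (Preorder.frestrictLe k Z) * g (Z (k + 1)) ∂(jumpChainLaw q x) =
      ∫⁻ Z, F (Preorder.frestrictLe k Z) * ∫⁻ z, g z ∂(jumpKernel q (Z k))
        ∂(jumpChainLaw q x) := by
  have hg : Measurable g := measurable_of_countable g
  have hm : Measurable fun p : ((i : Finset.Iic k) → S) × S => F p.1 * g p.2 := by fun_prop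
  have key := congrArg (fun μ => ∫⁻ p, F p.1 * g p.2 ∂μ)
    (Kernel.map_frestrictLe_trajMeasure_compProd_eq_map_trajMeasure (X := fun _ => S)
      (μ₀ := Measure.dirac x) (a := k) (κ := fun n =>
    (jumpKernel q).comap (fun h : (i : Finset.Iic n) → S => h ⟨n, Finset.mem_Iic.2 le_rfl⟩)
      (measurable_pi_apply _)))
  beta_reduce at key
  rw [Measure.lintegral_compProd hm, lintegral_map hm (by fun_prop),
    lintegral_map (by fun_prop) (by fun_prop)] at key
  refine key.symm.trans (lintegral_congr fun Z => ?_)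
  simp only [Kernel.comap_apply]
  rw [lintegral_const_mul _ hg]
  rfl

/-- Conditioning on the past peels off the last jump and replaces `g` by `tabooStep q x g`; hence
the induction runs over all `g`. -/
theorem lintegral_avoid (q : S → S → ℝ≥0∞) (x y : S) (k : ℕ) (g : S → ℝ≥0∞) :
    ∫⁻ Z, (avoid x k).indicator 1 Z * g (Z k) ∂(jumpChainLaw q y) =
      (tabooStep q x)^[k] g y := by
  induction k generalizing g with
  | zero =>
    rw [Function.iterate_zero, id, ← lintegral_jumpChainLaw_zero q y g]
    refine lintegral_congr fun Z => ?_
    have : Z ∈ avoid x 0 := fun j h1 h2 => by omega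
    simp [this]
  | succ k ih =>
    rw [Function.iterate_succ_apply, ← ih]
    let A : Set ((i : Finset.Iic k) → S) := {h | ∀ i, 1 ≤ i.1 → h i ≠ x}
    have hA : ∀ Z : ℕ → S, (avoid x k).indicator (1 : (ℕ → S) → ℝ≥0∞) Z =
        A.indicator 1 (Preorder.frestrictLe k Z) := by
      intro Z
      have : Z ∈ avoid x k ↔ Preorder.frestrictLe k Z ∈ A :=
        ⟨fun h i hi => h i.1 hi (Finset.mem_Iic.1 i.2),
          fun h j h1 h2 => h ⟨j, Finset.mem_Iic.2 h2⟩ h1⟩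
      by_cases h : Z ∈ avoid x k
      · rw [Set.indicator_of_mem h, Set.indicator_of_mem (this.1 h)]; rfl
      · rw [Set.indicator_of_notMem h, Set.indicator_of_notMem (fun h' => h (this.2 h'))]
    have hF : Measurable (A.indicator (1 : ((i : Finset.Iic k) → S) → ℝ≥0∞)) :=
      measurable_of_countable _
    have := lintegral_jumpChainLaw_succ q y k _ hF (({x}ᶜ : Set S).indicator g)
    calc _ = ∫⁻ Z, A.indicator 1 (Preorder.frestrictLe k Z) *
          ({x}ᶜ : Set S).indicator g (Z (k + 1)) ∂(jumpChainLaw q y) := by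
          refine lintegral_congr fun Z => ?_
          rw [← hA, avoid_succ]
          by_cases h1 : Z ∈ avoid x k <;> by_cases h2 : Z (k + 1) = x <;> simp [h1, h2]
      _ = _ := this
      _ = _ := lintegral_congr fun Z => by rw [← hA]; rfl

theorem measure_avoid (q : S → S → ℝ≥0∞) (x y : S) (k : ℕ) :
    jumpChainLaw q y (avoid x k) = (tabooStep q x)^[k] 1 y := by
  rw [← lintegral_avoid, ← lintegral_indicator_one (measurableSet_avoid x k)]
  simp

/-! ### From numbers of jumps to return times -/

theorem lintegral_expMeasure_one : ∫⁻ t, ENNReal.ofReal t ∂(expMeasure 1) = 1 := by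
  have hm : Measurable (gammaPDF 1 1) := (measurable_gammaPDFReal 1 1).ennreal_ofReal
  rw [expMeasure, gammaMeasure,
    lintegral_withDensity_eq_lintegral_mul _ hm ENNReal.measurable_ofReal,
    -- On t ≥ 0, t times the unit exponential density is the Gamma(2, 1) density, of total mass 1.
    ← lintegral_gammaPDF_eq_one (a := 2) (r := 1) two_pos one_pos]
  refine lintegral_congr fun t => ?_
  rcases lt_or_ge t 0 with ht | ht
  · simp [gammaPDF_of_neg ht]
  · have h2 : Real.Gamma 2 = 1 := Real.Gamma_two
    rw [Pi.mul_apply, gammaPDF_of_nonneg ht, gammaPDF_of_nonneg ht, h2,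
      ← ENNReal.ofReal_mul (by positivity)]
    norm_num
    ring_nf

theorem lintegral_law_avoid_mul (q : S → S → ℝ≥0∞) (x y : S) (k : ℕ) :
    ∫⁻ ω, (avoid x k).indicator 1 ω.1 * ENNReal.ofReal (ω.2 k) ∂(law q y) =
      (tabooStep q x)^[k] 1 y := by
  have : IsProbabilityMeasure (expMeasure 1) := isProbabilityMeasure_expMeasure one_pos
  rw [law, lintegral_prod_mul (f := (avoid x k).indicator 1)
    (g := fun e : ℕ → ℝ => ENNReal.ofReal (e k))
    ((measurable_one.indicator (measurableSet_avoid x k)).aemeasurable)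
    (ENNReal.measurable_ofReal.comp (measurable_pi_apply k)).aemeasurable,
    lintegral_indicator_one (measurableSet_avoid x k), measure_avoid]
  have h := (measurePreserving_eval_infinitePi (fun _ : ℕ => expMeasure 1) k).lintegral_comp
    ENNReal.measurable_ofReal
  simp only [Function.eval] at h
  rw [h, lintegral_expMeasure_one, mul_one]

theorem lintegral_tsum_avoid (q : S → S → ℝ≥0∞) (x y : S) (a : ℝ≥0∞) :
    ∫⁻ ω, ∑' k, (avoid x k).indicator 1 ω.1 * ENNReal.ofReal (ω.2 k) * a ∂(law q y) =
      (∑' k, (tabooStep q x)^[k] 1 y) * a := by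
  have hm : ∀ k, Measurable fun ω : (ℕ → S) × (ℕ → ℝ) =>
      (avoid x k).indicator (1 : (ℕ → S) → ℝ≥0∞) ω.1 * ENNReal.ofReal (ω.2 k) := fun k =>
    ((measurable_one.indicator (measurableSet_avoid x k)).comp measurable_fst).mul
      (ENNReal.measurable_ofReal.comp ((measurable_pi_apply k).comp measurable_snd))
  rw [lintegral_tsum fun k => ((hm k).mul_const a).aemeasurable, ← ENNReal.tsum_mul_right]
  exact tsum_congr fun k => by rw [lintegral_mul_const _ (hm k), lintegral_law_avoid_mul]

theorem ae_exists_return (q : S → S → ℝ≥0∞) (x : S)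
    (h : ∑' k, (tabooStep q x)^[k] 1 x ≠ ∞) : ∀ᵐ ω ∂(law q x), ∃ n, 1 ≤ n ∧ ω.1 n = x := by
  have : IsProbabilityMeasure (expMeasure 1) := isProbabilityMeasure_expMeasure one_pos
  have h0 : ∀ᵐ Z ∂(jumpChainLaw q x), ∃ n, 1 ≤ n ∧ Z n = x := by
    -- Never returning lies in every `avoid x k`, and these probabilities are summable, so they tend
    -- to 0.
    refine le_antisymm (ge_of_tendsto' (ENNReal.tendsto_atTop_zero_of_tsum_ne_top h)
      fun k => ?_) zero_le
    rw [← measure_avoid]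
    refine measure_mono fun Z hZ j h1 _ hj => ?_
    exact hZ ⟨j, h1, hj⟩
  exact Measure.quasiMeasurePreserving_fst.ae h0

/-- If the transition rates are bounded from below and the jump chain has a finite mean return
time, then so has the chain. -/
theorem lintegral_returnTime_lt_top (q : S → S → ℝ≥0∞) (x : S) (a : ℝ≥0∞) (ha : a ≠ 0)
    (hq : ∀ y, a ≤ totalRate q y) (h : ∑' k, (tabooStep q x)^[k] 1 x ≠ ∞) :
    ∫⁻ ω, returnTime q x ω ∂(law q x) < ∞ := by
  have hle : ∀ᵐ ω ∂(law q x), returnTime q x ω ≤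
      ∑' k, (avoid x k).indicator 1 ω.1 * ENNReal.ofReal (ω.2 k) * a⁻¹ := by
    filter_upwards [ae_exists_return q x h] with ω hω
    classical
    have hn := Nat.find_spec hω
    refine (iInf₂_le (Nat.find hω) hn).trans
      (le_trans (Finset.sum_le_sum fun k hk => ?_) (ENNReal.sum_le_tsum (Finset.range _)))
    -- The holding time of index `k` counts only if `k` precedes the first return, that is, if `x`
    -- is avoided up to `k`.
    have hk' : ω.1 ∈ avoid x k := fun j h1 h2 hj =>
      Nat.find_min hω (h2.trans_lt (Finset.mem_range.1 hk)) ⟨h1, hj⟩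
    rw [Set.indicator_of_mem hk', Pi.one_apply, one_mul]
    exact ENNReal.div_le_div_left (hq _) _
  refine (lintegral_mono_ae hle).trans_lt ?_
  rw [lintegral_tsum_avoid]
  exact ENNReal.mul_lt_top h.lt_top (ENNReal.inv_lt_top.2 (pos_iff_ne_zero.2 ha))

/-- If the transition rates are bounded from above, then the mean return time of the chain is
bounded from below by that of the jump chain. -/
theorem le_lintegral_returnTime (q : S → S → ℝ≥0∞) (x : S) (b : ℝ≥0∞)
    (hq : ∀ y, totalRate q y ≤ b) :
    (∑' k, (tabooStep q x)^[k] 1 x) * b⁻¹ ≤ ∫⁻ ω, returnTime q x ω ∂(law q x) := by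
  rw [← lintegral_tsum_avoid]
  refine lintegral_mono fun ω => le_iInf₂ fun n hn => ?_
  rw [tsum_eq_sum (s := Finset.range n)]
  · refine Finset.sum_le_sum fun k _ => ?_
    refine le_trans ?_ (ENNReal.div_le_div_left (hq (ω.1 k)) _)
    rw [ENNReal.div_eq_inv_mul, mul_comm]
    gcongr
    exact (mul_le_of_le_one_left zero_le (Set.indicator_le_self' (by simp) _))
  · intro k hk
    have : ω.1 ∉ avoid x k := fun h =>
      h n hn.1 (not_lt.1 fun h' => hk (Finset.mem_range.2 h')) hn.2
    simp [this]

/-! ### Criteria for positive recurrence and for its failure -/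

theorem lintegral_jumpKernel (q : S → S → ℝ≥0∞) (y : S) (h0 : totalRate q y ≠ 0)
    (h1 : totalRate q y ≠ ∞) (g : S → ℝ≥0∞) :
    ∫⁻ z, g z ∂(jumpKernel q y) = (totalRate q y)⁻¹ * ∑' z, q y z * g z := by
  rw [lintegral_countable', ← ENNReal.tsum_mul_left]
  refine tsum_congr fun z => ?_
  have : jumpKernel q y {z} = q y z * (totalRate q y)⁻¹ := by
    change (jumpLaw q y).toMeasure {z} = _
    rw [PMF.toMeasure_apply_singleton _ _ (measurableSet_singleton z), jumpLaw,
      dif_pos ⟨h0, h1⟩]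
    rfl
  rw [this]
  ring

theorem tabooStep_mono (q : S → S → ℝ≥0∞) (x : S) : Monotone (tabooStep q x) :=
  fun _ _ h _ => lintegral_mono fun _ => Set.indicator_le_indicator (h _)

/-- A detailed balance measure, weighted by the total rates, is invariant for the jump chain. -/
theorem tsum_mul_lintegral_jumpKernel (q : S → S → ℝ≥0∞) (π : S → ℝ≥0∞)
    (h0 : ∀ y, totalRate q y ≠ 0) (h1 : ∀ y, totalRate q y ≠ ∞)
    (hπ : ∀ y z, π y * q y z = π z * q z y) (g : S → ℝ≥0∞) :
    ∑' y, π y * totalRate q y * ∫⁻ z, g z ∂(jumpKernel q y) =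
      ∑' y, π y * totalRate q y * g y := by
  calc _ = ∑' y, ∑' z, π z * q z y * g z := by
        refine tsum_congr fun y => ?_
        rw [lintegral_jumpKernel q y (h0 y) (h1 y), ← mul_assoc, mul_assoc (π y),
          ENNReal.mul_inv_cancel (h0 y) (h1 y), mul_one, ← ENNReal.tsum_mul_left]
        exact tsum_congr fun z => by rw [← hπ, mul_assoc]
    _ = _ := by
        rw [ENNReal.tsum_comm]
        refine tsum_congr fun y => ?_
        rw [ENNReal.tsum_mul_right, ENNReal.tsum_mul_left]
        rfl

/-- **Kac's inequality**: a finite invariant measure of the jump chain bounds the mean return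
times. -/
theorem mul_tsum_tabooStep_le (q : S → S → ℝ≥0∞) (w : S → ℝ≥0∞)
    (hw : ∀ g : S → ℝ≥0∞, ∑' y, w y * ∫⁻ z, g z ∂(jumpKernel q y) = ∑' y, w y * g y)
    (x : S) : w x * ∑' k, (tabooStep q x)^[k + 1] 1 x ≤ ∑' y, w y := by
  classical
  let b : ℕ → S → ℝ≥0∞ := fun k => ({x}ᶜ : Set S).indicator ((tabooStep q x)^[k] 1)
  -- Invariance lets one more jump be made before `b k` is evaluated; splitting off the starting
  -- state `x` makes the sums telescope.
  have hstep : ∀ k, w x * (tabooStep q x)^[k + 1] 1 x + ∑' y, w y * b (k + 1) y =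
      ∑' y, w y * b k y := by
    intro k
    rw [← hw (b k), ENNReal.tsum_eq_add_tsum_ite x,
      ENNReal.tsum_eq_add_tsum_ite (f := fun y => w y * ∫⁻ z, b k z ∂(jumpKernel q y)) x]
    simp only [Function.iterate_succ_apply']
    have hx : b (k + 1) x = 0 := by simp [b]
    rw [hx, mul_zero, zero_add]
    congr 1
    refine tsum_congr fun y => ?_
    by_cases hy : y = x
    · simp [hy]
    · have : b (k + 1) y = tabooStep q x ((tabooStep q x)^[k] 1) y := by
        simp only [b, Function.iterate_succ_apply']
        exact Set.indicator_of_mem hy _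
      simp only [hy, if_false, this]
      rfl
  have hsum : ∀ n, w x * ∑ k ∈ Finset.range n, (tabooStep q x)^[k + 1] 1 x +
      ∑' y, w y * b n y = ∑' y, w y * b 0 y := by
    intro n
    induction n with
    | zero => simp
    | succ n ih => rw [Finset.sum_range_succ, mul_add, add_assoc, hstep, ih]
  rw [ENNReal.tsum_eq_iSup_nat, ENNReal.mul_iSup]
  refine iSup_le fun n => (le_self_add.trans (hsum n).le).trans (ENNReal.tsum_le_tsum fun y => ?_)
  refine mul_le_of_le_one_right zero_le ?_
  exact Set.indicator_le_self' (f := (1 : S → ℝ≥0∞)) (by simp) y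

/-- A chain with transition rates bounded away from `0` and a detailed balance measure of finite
total rate is positive recurrent. -/
theorem positiveRecurrentFrom_of_detailedBalance (q : S → S → ℝ≥0∞) (π : S → ℝ≥0∞) (x₀ : S)
    (a : ℝ≥0∞) (ha : a ≠ 0) (hq : ∀ y, a ≤ totalRate q y) (h1 : ∀ y, totalRate q y ≠ ∞)
    (hπ : ∀ y z, π y * q y z = π z * q z y) (hfin : ∑' y, π y * totalRate q y ≠ ∞)
    (hx₀ : π x₀ ≠ 0) : PositiveRecurrentFrom q x₀ := by
  intro y hy
  have h0 : ∀ y, totalRate q y ≠ 0 := fun y h => ha (le_zero_iff.1 (h ▸ hq y))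
  -- Detailed balance carries positivity of the weight along each transition.
  have hπy : π y ≠ 0 := by
    induction hy with
    | refl => exact hx₀
    | tail _ h ih =>
      intro h'
      have := hπ _ _ ▸ mul_ne_zero ih h.ne'
      simp [h'] at this
  refine Or.inr (lintegral_returnTime_lt_top q y a ha hq ?_)
  have hkac := mul_tsum_tabooStep_le q (fun y => π y * totalRate q y)
    (tsum_mul_lintegral_jumpKernel q π h0 h1 hπ) y
  -- Kac's bound starts at one jump; the term of index 0 is just 1.
  rw [tsum_eq_zero_add' ENNReal.summable]
  refine ENNReal.add_ne_top.2 ⟨by simp, fun htop => hfin ?_⟩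
  rw [htop, ENNReal.mul_top (mul_ne_zero hπy (h0 y))] at hkac
  exact top_le_iff.1 hkac

/-- After `n` jumps `f` is at most `f y + n`, so only the surviving probability is left to
integrate. -/
theorem iterate_tabooStep_le (q : S → S → ℝ≥0∞) (x : S) (f : S → ℝ≥0∞)
    (h0 : ∀ y, totalRate q y ≠ 0) (h1 : ∀ y, totalRate q y ≠ ∞)
    (hf : ∀ y z, q y z ≠ 0 → f z ≤ f y + 1) (n : ℕ) (y : S) :
    (tabooStep q x)^[n] f y ≤ (f y + n) * (tabooStep q x)^[n] 1 y := by
  induction n generalizing y with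
  | zero => simp
  | succ n ih =>
    simp only [Function.iterate_succ_apply']
    rw [tabooStep, tabooStep, lintegral_jumpKernel q y (h0 y) (h1 y),
      lintegral_jumpKernel q y (h0 y) (h1 y), mul_left_comm]
    refine mul_le_mul_right (?_ : _ ≤ _) _
    rw [← ENNReal.tsum_mul_left]
    refine ENNReal.tsum_le_tsum fun z => ?_
    by_cases hz : q y z = 0
    · simp [hz]
    · rw [mul_left_comm]
      refine mul_le_mul_right (?_ : _ ≤ _) _
      by_cases hzx : z = x
      · simp [hzx]
      · rw [Set.indicator_of_mem (show z ∈ ({x}ᶜ : Set S) from hzx),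
          Set.indicator_of_mem (show z ∈ ({x}ᶜ : Set S) from hzx)]
        refine (ih z).trans (mul_le_mul_left (?_ : _ ≤ _) _)
        refine (add_le_add_left (hf y z hz) _).trans (le_of_eq ?_)
        push_cast
        ring

theorem tsum_inv_nat_succ : ∑' n : ℕ, ((n : ℝ≥0∞) + 1)⁻¹ = ∞ := by
  by_contra h
  have hs := ENNReal.summable_toReal h
  refine Real.not_summable_natCast_inv ((summable_nat_add_iff 1).1 (hs.congr fun n => ?_))
  rw [ENNReal.toReal_inv]
  norm_cast

/-- A chain with bounded rates and a nonnegative function `f` with jumps at most `1`,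
nonnegative drift everywhere and positive drift at `x`, where
`f x = 0`, is not positive recurrent. -/
theorem not_positiveRecurrentState (q : S → S → ℝ≥0∞) (x : S) (f : S → ℝ≥0∞)
    (b : ℝ≥0∞) (hb : b ≠ ∞) (h0 : ∀ y, totalRate q y ≠ 0) (h1 : ∀ y, totalRate q y ≤ b)
    (hf : ∀ y z, q y z ≠ 0 → f z ≤ f y + 1)
    (hdrift : ∀ y, totalRate q y * f y ≤ ∑' z, q y z * f z)
    (hx : f x = 0) (hpos : ∑' z, q x z * f z ≠ 0) : ¬ PositiveRecurrentState q x := by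
  have h1' : ∀ y, totalRate q y ≠ ∞ := fun y => ne_top_of_le_ne_top hb (h1 y)
  -- Killing at `x` costs nothing because `f x = 0`; so `f` is subinvariant for the killed chain
  -- too.
  have hstep : ∀ y, tabooStep q x f y = (totalRate q y)⁻¹ * ∑' z, q y z * f z := by
    intro y
    rw [tabooStep, ← lintegral_jumpKernel q y (h0 y) (h1' y)]
    refine lintegral_congr fun z => ?_
    by_cases hz : z = x
    · simp [hz, hx]
    · exact Set.indicator_of_mem hz _
  have hle : f ≤ tabooStep q x f := by
    intro y
    rw [hstep, ← ENNReal.mul_le_iff_le_inv (h0 y) (h1' y)]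
    exact hdrift y
  have hmono := (tabooStep_mono q x).monotone_iterate_of_le_map hle
  -- The iterates of `f` increase, while the one of order `n + 1` at `x` is at most `n + 1` times
  -- the avoidance probability.
  have hn : ∀ n : ℕ, tabooStep q x f x * ((n : ℝ≥0∞) + 1)⁻¹ ≤ (tabooStep q x)^[n + 1] 1 x := by
    intro n
    have h2 : tabooStep q x f x ≤ (tabooStep q x)^[n + 1] f x :=
      hmono (show 1 ≤ n + 1 by omega) x
    have h3 := h2.trans (iterate_tabooStep_le q x f h0 h1' hf (n + 1) x)
    rw [hx, zero_add, mul_comm] at h3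
    rw [← div_eq_mul_inv]
    refine ENNReal.div_le_of_le_mul ?_
    exact_mod_cast h3
  have hinf : ∑' k, (tabooStep q x)^[k] 1 x = ∞ := by
    rw [tsum_eq_zero_add' ENNReal.summable, ENNReal.add_eq_top]
    right
    refine top_le_iff.1 (le_trans (le_of_eq ?_) (ENNReal.tsum_le_tsum hn))
    rw [ENNReal.tsum_mul_left, tsum_inv_nat_succ, ENNReal.mul_top]
    rw [hstep]
    exact mul_ne_zero (ENNReal.inv_ne_zero.2 (h1' x)) hpos
  rintro (h | h)
  · exact h0 x h
  · have := (le_lintegral_returnTime q x b h1).trans_lt h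
    rw [hinf, ENNReal.top_mul (ENNReal.inv_ne_zero.2 hb)] at this
    exact lt_irrefl _ this

end CTMC

/-! ### Transition rates under the SNR based policy -/

namespace TwoBS

theorem bestRate_rateVector (N : Network) (hc : N.c 0 < N.c 1) (k : Fin 2) :
    bestRate (N.rateVector k) = {k} := by
  ext i
  fin_cases k <;> fin_cases i <;>
    simp [bestRate, Network.rateVector, linkClass, hc, hc.le]

namespace Network

variable (N : Network)

/-- Rate of the arrivals at base station `i` with the rate of class `r`. -/
def arrivalRate (i r : Fin 2) : ℝ≥0∞ :=
  if r = 1 then ENNReal.ofReal N.lam * ENNReal.ofReal (N.p i) else 0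

/-- Rate of the departures of users of class `r` from base station `i`, where `v` gives the numbers
of users of the two classes. -/
def departureRate (i r : Fin 2) (v : Fin 2 → ℕ) : ℝ≥0∞ :=
  ENNReal.ofReal (N.mu * v r * (min (N.m i : ℝ) (∑ l, v l : ℕ) * N.c r / (∑ l, v l : ℕ)))

theorem joinProb_snrPolicy (hc : N.c 0 < N.c 1) (s : State) (i r : Fin 2) :
    N.joinProb snrPolicy s i r = if r = 1 then ENNReal.ofReal (N.p i) else 0 := by
  have h : ∀ k, snrPolicy s (N.rateVector k) i = if i = k then 1 else 0 := by
    intro k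
    rw [snrPolicy, PMF.uniformOfFinset_apply, bestRate_rateVector N hc]
    simp
  simp only [joinProb, h, Fin.sum_univ_two]
  fin_cases i <;> fin_cases r <;> simp [linkClass]

theorem transitionRate_snrPolicy (hc : N.c 0 < N.c 1) (s t : State) :
    N.transitionRate snrPolicy s t =
      ∑ i, ∑ r, ((if t = s + oneUser i r then N.arrivalRate i r else 0) +
        (if s = t + oneUser i r then N.departureRate i r (s i) else 0)) := by
  simp only [transitionRate, joinProb_snrPolicy N hc, mul_ite, mul_zero]
  rfl

theorem departureRate_eq_zero {i r : Fin 2} {v : Fin 2 → ℕ} (h : v r = 0) :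
    N.departureRate i r v = 0 := by
  simp [departureRate, h]

theorem sub_add_oneUser {s : State} {i r : Fin 2} (h : s i r ≠ 0) :
    s - oneUser i r + oneUser i r = s := by
  refine tsub_add_cancel_of_le fun j l => ?_
  by_cases hj : j = i
  · subst hj
    by_cases hl : l = r
    · subst hl
      simpa [oneUser] using Nat.one_le_iff_ne_zero.2 h
    · simp [oneUser, hl]
  · simp [oneUser, hj]

theorem tsum_transitionRate_mul (hc : N.c 0 < N.c 1) (s : State) (g : State → ℝ≥0∞) :
    ∑' t, N.transitionRate snrPolicy s t * g t =
      ∑ i, ∑ r, (N.arrivalRate i r * g (s + oneUser i r) +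
        N.departureRate i r (s i) * g (s - oneUser i r)) := by
  simp only [transitionRate_snrPolicy N hc, Finset.sum_mul, add_mul]
  rw [Summable.tsum_finsetSum fun _ _ => ENNReal.summable]
  refine Finset.sum_congr rfl fun i _ => ?_
  rw [Summable.tsum_finsetSum fun _ _ => ENNReal.summable]
  refine Finset.sum_congr rfl fun r _ => ?_
  rw [ENNReal.tsum_add]
  congr 1
  · rw [tsum_eq_single (s + oneUser i r) fun t ht => by simp [ht]]
    simp
  -- Truncated subtraction would leave `s` unchanged here, but the departure rate vanishes.
  · by_cases h : s i r = 0
    · simp [departureRate_eq_zero N h]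
    · rw [tsum_eq_single (s - oneUser i r) fun t ht => ?_]
      · rw [if_pos (sub_add_oneUser h).symm]
      · rw [if_neg, zero_mul]
        rintro rfl
        exact ht (add_tsub_cancel_right t _).symm

theorem totalRate_snrPolicy (hc : N.c 0 < N.c 1) (s : State) :
    CTMC.totalRate (N.transitionRate snrPolicy) s =
      ∑ i, ∑ r, (N.arrivalRate i r + N.departureRate i r (s i)) := by
  simpa [CTMC.totalRate] using N.tsum_transitionRate_mul hc s 1

theorem sum_arrivalRate (i : Fin 2) :
    ∑ r, N.arrivalRate i r = ENNReal.ofReal N.lam * ENNReal.ofReal (N.p i) := by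
  simp [arrivalRate]

/-- The total throughput is the number of busy RF chains times the mean data rate of the users,
which is at most `N.c 1`. -/
theorem sum_departureRate_le (hmu : 0 < N.mu) (hc₀ : 0 < N.c 0) (hc : N.c 0 < N.c 1)
    (i : Fin 2) (v : Fin 2 → ℕ) :
    ∑ r, N.departureRate i r v ≤ ENNReal.ofReal (N.mu * N.c 1 * N.m i) := by
  have hc₁ := hc₀.trans hc
  rw [Fin.sum_univ_two, departureRate, departureRate, ← ENNReal.ofReal_add
    (by positivity) (by positivity)]
  refine ENNReal.ofReal_le_ofReal ?_
  rw [Fin.sum_univ_two]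
  push_cast
  rcases eq_or_lt_of_le (show (0 : ℝ) ≤ v 0 + v 1 by positivity) with h | h
  · rw [← h]
    simp only [div_zero, mul_zero, add_zero]
    positivity
  · have h1 : (v 0 : ℝ) * N.c 0 + v 1 * N.c 1 ≤ (v 0 + v 1) * N.c 1 := by
      rw [add_mul]
      gcongr
    calc _ = N.mu * min (N.m i : ℝ) (v 0 + v 1) *
          ((v 0 * N.c 0 + v 1 * N.c 1) / (v 0 + v 1)) := by ring
      _ ≤ N.mu * N.m i * N.c 1 := by
          gcongr
          · exact min_le_left _ _
          · rw [div_le_iff₀ h]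
            linarith
      _ = _ := by ring

theorem ofReal_lam_le_totalRate (hc : N.c 0 < N.c 1) (hp₀ : 0 ≤ N.p 0)
    (hp₁ : 0 ≤ N.p 1) (hp : N.p 0 + N.p 1 = 1) (s : State) :
    ENNReal.ofReal N.lam ≤ CTMC.totalRate (N.transitionRate snrPolicy) s := by
  rw [totalRate_snrPolicy N hc]
  calc ENNReal.ofReal N.lam = ∑ i, ∑ r, N.arrivalRate i r := by
        simp only [sum_arrivalRate]
        rw [Fin.sum_univ_two]
        rw [← mul_add, ← ENNReal.ofReal_add hp₀ hp₁, hp, ENNReal.ofReal_one, mul_one]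
    _ ≤ _ := Finset.sum_le_sum fun i _ => Finset.sum_le_sum fun r _ => le_self_add

/-- An upper bound for the total transition rates. -/
def maxRate : ℝ≥0∞ :=
  ∑ i, (ENNReal.ofReal N.lam * ENNReal.ofReal (N.p i) + ENNReal.ofReal (N.mu * N.c 1 * N.m i))

theorem maxRate_ne_top : N.maxRate ≠ ∞ := by
  simp [maxRate, ENNReal.mul_eq_top]

theorem totalRate_le_maxRate (hmu : 0 < N.mu) (hc₀ : 0 < N.c 0) (hc : N.c 0 < N.c 1)
    (s : State) : CTMC.totalRate (N.transitionRate snrPolicy) s ≤ N.maxRate := by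
  rw [totalRate_snrPolicy N hc, maxRate]
  refine Finset.sum_le_sum fun i _ => ?_
  rw [Finset.sum_add_distrib, sum_arrivalRate]
  gcongr
  exact N.sum_departureRate_le hmu hc₀ hc i (s i)

/-! ### Instability -/

/-- The number of users associated with base station `i`. -/
def users (i : Fin 2) (s : State) : ℝ≥0∞ := (∑ l, s i l : ℕ)

theorem users_add_oneUser (i j r : Fin 2) (s : State) :
    users i (s + oneUser j r) = users i s + if j = i then 1 else 0 := by
  by_cases h : j = i
  · subst h
    simp [users, oneUser, Finset.sum_add_distrib]
  · have h' : i ≠ j := fun e => h e.symm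
    simp [users, oneUser, h, h']

theorem users_le_of_transitionRate_ne_zero (hc : N.c 0 < N.c 1) (i : Fin 2) (s t : State)
    (h : N.transitionRate snrPolicy s t ≠ 0) : users i t ≤ users i s + 1 := by
  by_contra hlt
  refine h ?_
  rw [transitionRate_snrPolicy N hc]
  refine Finset.sum_eq_zero fun j _ => Finset.sum_eq_zero fun r _ => ?_
  rw [if_neg, if_neg, add_zero]
  · rintro rfl
    rw [users_add_oneUser, add_assoc] at hlt
    exact hlt le_self_add
  · rintro rfl
    rw [users_add_oneUser] at hlt
    refine hlt (add_le_add_right ?_ _)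
    split_ifs <;> simp

theorem totalRate_mul_users_le (hmu : 0 < N.mu) (hc₀ : 0 < N.c 0) (hc : N.c 0 < N.c 1)
    (hlam : 0 < N.lam) (i : Fin 2) (h : N.mu * N.c 1 * N.m i ≤ N.lam * N.p i) (s : State) :
    CTMC.totalRate (N.transitionRate snrPolicy) s * users i s ≤
      ∑' t, N.transitionRate snrPolicy s t * users i t := by
  have harr : ∑ r, N.arrivalRate i r ≠ ∞ := by
    rw [sum_arrivalRate]
    exact ENNReal.mul_ne_top ENNReal.ofReal_ne_top ENNReal.ofReal_ne_top
  have hdep : ∑ r, N.departureRate i r (s i) ≤ ∑ r, N.arrivalRate i r := by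
    rw [sum_arrivalRate, ← ENNReal.ofReal_mul hlam.le]
    exact (N.sum_departureRate_le hmu hc₀ hc i (s i)).trans (ENNReal.ofReal_le_ofReal h)
  have hpick : ∀ F : Fin 2 → Fin 2 → ℝ≥0∞,
      ∑ j, ∑ r, F j r * (if j = i then 1 else 0) = ∑ r, F i r := by
    intro F
    rw [Finset.sum_eq_single i (fun j _ hj => by simp [hj]) (by simp)]
    simp
  have hD : ∀ j r, N.departureRate j r (s j) * users i (s - oneUser j r) +
      N.departureRate j r (s j) * (if j = i then 1 else 0) =
        N.departureRate j r (s j) * users i s := by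
    intro j r
    by_cases hs : s j r = 0
    · simp [departureRate_eq_zero N hs]
    · rw [← mul_add, ← users_add_oneUser i j r, sub_add_oneUser hs]
  -- Drift equals arrivals minus departures at station `i`, written additively to avoid subtraction
  -- in `ℝ≥0∞`.
  have key : (∑' t, N.transitionRate snrPolicy s t * users i t) +
      ∑ r, N.departureRate i r (s i) =
      CTMC.totalRate (N.transitionRate snrPolicy) s * users i s + ∑ r, N.arrivalRate i r := by
    rw [tsum_transitionRate_mul N hc, totalRate_snrPolicy N hc,
      ← hpick fun j r => N.departureRate j r (s j), ← hpick N.arrivalRate,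
      Finset.sum_mul, ← Finset.sum_add_distrib, ← Finset.sum_add_distrib]
    refine Finset.sum_congr rfl fun j _ => ?_
    rw [Finset.sum_mul, ← Finset.sum_add_distrib, ← Finset.sum_add_distrib]
    refine Finset.sum_congr rfl fun r _ => ?_
    rw [add_assoc, hD, users_add_oneUser]
    ring
  refine ENNReal.le_of_add_le_add_right harr ?_
  rw [← key]
  gcongr

theorem not_stable_snrPolicy (hlam : 0 < N.lam) (hmu : 0 < N.mu) (hc₀ : 0 < N.c 0)
    (hc : N.c 0 < N.c 1) (hp₀ : 0 ≤ N.p 0) (hp₁ : 0 ≤ N.p 1) (hp : N.p 0 + N.p 1 = 1)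
    (i : Fin 2) (hm : 1 ≤ N.m i) (h : N.mu * N.c 1 * N.m i ≤ N.lam * N.p i) :
    ¬ N.Stable snrPolicy := by
  intro hst
  have h0 : ∀ s, CTMC.totalRate (N.transitionRate snrPolicy) s ≠ 0 := fun s hs =>
    (ENNReal.ofReal_pos.2 hlam).not_ge
      (hs ▸ N.ofReal_lam_le_totalRate hc hp₀ hp₁ hp s)
  refine CTMC.not_positiveRecurrentState _ 0 (users i) N.maxRate N.maxRate_ne_top h0
    (N.totalRate_le_maxRate hmu hc₀ hc) (N.users_le_of_transitionRate_ne_zero hc i)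
    (N.totalRate_mul_users_le hmu hc₀ hc hlam i h) (by simp [users]) ?_
    (hst 0 Relation.ReflTransGen.refl)
  have hpi : 0 < N.p i := by
    have hm' : (0 : ℝ) < N.m i := by exact_mod_cast hm
    have := hc₀.trans hc
    exact pos_of_mul_pos_right (lt_of_lt_of_le (by positivity) h) hlam.le
  rw [tsum_transitionRate_mul N hc]
  intro h'
  have h1 := (Finset.sum_eq_zero_iff.1 (Finset.sum_eq_zero_iff.1 h' i (Finset.mem_univ i)) 1
    (Finset.mem_univ 1))
  rw [users_add_oneUser] at h1
  have h2 := (ENNReal.ofReal_pos.2 hlam).ne'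
  have h3 := (ENNReal.ofReal_pos.2 hpi).ne'
  simp only [add_eq_zero, mul_eq_zero, arrivalRate, if_true] at h1
  rcases h1.1 with h4 | h4
  · exact h4.elim h2 h3
  · simp at h4

/-! ### Stability -/

/-- The stationary weights of the `M/M/m` queue of base station `i`. -/
def queueWeight (i : Fin 2) (n : ℕ) : ℝ :=
  ∏ j ∈ Finset.range n, N.lam * N.p i / (N.mu * N.c 1 * min (N.m i : ℝ) (j + 1))

/-- The stationary weights of the numbers of users of the two classes at base station `i`. -/
def stationWeight (i : Fin 2) (v : Fin 2 → ℕ) : ℝ≥0∞ :=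
  if v 0 = 0 then ENNReal.ofReal (N.queueWeight i (v 1)) else 0

/-- The product form measure of the network. -/
def networkWeight (s : State) : ℝ≥0∞ := ∏ i, N.stationWeight i (s i)

/-- Without class `0` users this is the M/M/m balance equation, built into the ratios of
`queueWeight`. In all other cases both sides vanish. -/
theorem stationWeight_mul_arrivalRate (hlam : 0 < N.lam) (hmu : 0 < N.mu) (hc₁ : 0 < N.c 1)
    (i r : Fin 2) (hp : 0 ≤ N.p i) (hm : 1 ≤ N.m i) (v : Fin 2 → ℕ) :
    N.stationWeight i v * N.arrivalRate i r =
      N.stationWeight i (v + Pi.single r 1) * N.departureRate i r (v + Pi.single r 1) := by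
  fin_cases r
  · simp [arrivalRate, stationWeight]
  · by_cases hv : v 0 = 0
    · have hm' : (0 : ℝ) < N.m i := by exact_mod_cast hm
      have hmin : 0 < min (N.m i : ℝ) (v 1 + 1) := lt_min hm' (by positivity)
      have hW : ∀ n, 0 ≤ N.queueWeight i n := fun n =>
        Finset.prod_nonneg fun j _ => by positivity
      simp only [Fin.mk_one, arrivalRate, if_true, stationWeight, departureRate, Pi.add_apply,
        hv, Pi.single_eq_same, Fin.sum_univ_two, Pi.single_apply]
      norm_num
      rw [← ENNReal.ofReal_mul hlam.le, ← ENNReal.ofReal_mul (hW _), ← ENNReal.ofReal_mul (hW _)]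
      congr 1
      rw [queueWeight, queueWeight, Finset.prod_range_succ]
      field_simp
    · simp [stationWeight, hv]

theorem networkWeight_mul_arrivalRate (hlam : 0 < N.lam) (hmu : 0 < N.mu) (hc₁ : 0 < N.c 1)
    (i r : Fin 2) (hp : 0 ≤ N.p i) (hm : 1 ≤ N.m i) (s : State) :
    N.networkWeight s * N.arrivalRate i r =
      N.networkWeight (s + oneUser i r) * N.departureRate i r ((s + oneUser i r) i) := by
  have hi : (s + oneUser i r) i = s i + Pi.single r 1 := by simp [oneUser]
  have hsplit : ∀ t : State, N.networkWeight t =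
      N.stationWeight i (t i) * ∏ j ∈ Finset.univ.erase i, N.stationWeight j (t j) := fun t =>
    (Finset.mul_prod_erase _ _ (Finset.mem_univ i)).symm
  have hrest : ∏ j ∈ Finset.univ.erase i, N.stationWeight j ((s + oneUser i r) j) =
      ∏ j ∈ Finset.univ.erase i, N.stationWeight j (s j) :=
    Finset.prod_congr rfl fun j hj => by simp [oneUser, Finset.ne_of_mem_erase hj]
  rw [hsplit, hsplit, hrest, hi, mul_right_comm,
    stationWeight_mul_arrivalRate N hlam hmu hc₁ i r hp hm, mul_right_comm]

theorem networkWeight_detailedBalance (hlam : 0 < N.lam) (hmu : 0 < N.mu)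
    (hc₀ : 0 < N.c 0) (hc : N.c 0 < N.c 1) (hp : ∀ i, 0 ≤ N.p i) (hm : ∀ i, 1 ≤ N.m i)
    (s t : State) :
    N.networkWeight s * N.transitionRate snrPolicy s t =
      N.networkWeight t * N.transitionRate snrPolicy t s := by
  simp only [transitionRate_snrPolicy N hc, Finset.mul_sum]
  refine Finset.sum_congr rfl fun i _ => Finset.sum_congr rfl fun r _ => ?_
  have key := N.networkWeight_mul_arrivalRate hlam hmu (hc₀.trans hc) i r (hp i) (hm i)
  -- Swapping the summands pairs each arrival from `s` to `t` with the departure that undoes it, and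
  -- conversely.
  rw [mul_add, mul_add, add_comm (N.networkWeight t * _)]
  congr 1
  · split_ifs with h
    · rw [h, key]
    · simp
  · split_ifs with h
    · rw [h, key]
    · simp

theorem summable_queueWeight (hlam : 0 < N.lam) (hmu : 0 < N.mu) (hc₁ : 0 < N.c 1)
    (i : Fin 2) (hp : 0 ≤ N.p i) (hm : 1 ≤ N.m i)
    (h : N.lam * N.p i < N.mu * N.c 1 * N.m i) : Summable (N.queueWeight i) := by
  have hm' : (0 : ℝ) < N.m i := by exact_mod_cast hm
  have hr : N.lam * N.p i / (N.mu * N.c 1 * N.m i) < 1 := (div_lt_one (by positivity)).2 h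
  refine summable_of_ratio_norm_eventually_le hr ?_
  -- Once all RF chains are busy, the ratio of successive weights is the constant load, which is
  -- below 1.
  filter_upwards [Filter.eventually_ge_atTop (N.m i)] with n hn
  have hn' : (N.m i : ℝ) ≤ n + 1 := by exact_mod_cast hn.trans (Nat.le_succ n)
  rw [queueWeight, Finset.prod_range_succ, norm_mul, mul_comm, min_eq_left hn',
    Real.norm_of_nonneg (by positivity : 0 ≤ N.lam * N.p i / (N.mu * N.c 1 * N.m i))]
  rfl

/-- Used twice: over the two classes at a station and over the two stations. -/
theorem tsum_finTwo {α : Type*} (f g : α → ℝ≥0∞) :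
    ∑' v : Fin 2 → α, f (v 0) * g (v 1) = (∑' a, f a) * ∑' b, g b := by
  rw [← (finTwoArrowEquiv α).symm.tsum_eq, ENNReal.tsum_prod', ← ENNReal.tsum_mul_right]
  refine tsum_congr fun a => ?_
  rw [← ENNReal.tsum_mul_left]
  simp [finTwoArrowEquiv]

theorem tsum_stationWeight_ne_top (hlam : 0 < N.lam) (hmu : 0 < N.mu) (hc₁ : 0 < N.c 1)
    (i : Fin 2) (hp : 0 ≤ N.p i) (hm : 1 ≤ N.m i)
    (h : N.lam * N.p i < N.mu * N.c 1 * N.m i) : ∑' v, N.stationWeight i v ≠ ∞ := by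
  have : ∀ v, N.stationWeight i v =
      (if v 0 = 0 then 1 else 0) * ENNReal.ofReal (N.queueWeight i (v 1)) := fun v => by
    simp [stationWeight]
  simp_rw [this]
  rw [tsum_finTwo (fun a => if a = 0 then 1 else 0) fun n => ENNReal.ofReal (N.queueWeight i n),
    tsum_ite_eq, one_mul]
  exact (N.summable_queueWeight hlam hmu hc₁ i hp hm h).tsum_ofReal_ne_top

theorem stable_snrPolicy (hlam : 0 < N.lam) (hmu : 0 < N.mu) (hc₀ : 0 < N.c 0)
    (hc : N.c 0 < N.c 1) (hp : ∀ i, 0 ≤ N.p i) (hp' : N.p 0 + N.p 1 = 1) (hm : ∀ i, 1 ≤ N.m i)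
    (h : ∀ i, N.lam * N.p i < N.mu * N.c 1 * N.m i) : N.Stable snrPolicy := by
  have hfin : ∀ i, ∑' v, N.stationWeight i v ≠ ∞ := fun i =>
    N.tsum_stationWeight_ne_top hlam hmu (hc₀.trans hc) i (hp i) (hm i) (h i)
  refine CTMC.positiveRecurrentFrom_of_detailedBalance _ N.networkWeight 0
    (ENNReal.ofReal N.lam) (ENNReal.ofReal_pos.2 hlam).ne'
    (N.ofReal_lam_le_totalRate hc (hp 0) (hp 1) hp')
    (fun s => ne_top_of_le_ne_top N.maxRate_ne_top (N.totalRate_le_maxRate hmu hc₀ hc s))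
    (N.networkWeight_detailedBalance hlam hmu hc₀ hc hp hm) ?_
    (by simp [networkWeight, stationWeight, queueWeight])
  refine ne_top_of_le_ne_top ?_
    (ENNReal.tsum_le_tsum fun s => mul_le_mul_right (N.totalRate_le_maxRate hmu hc₀ hc s) _)
  rw [ENNReal.tsum_mul_right]
  refine ENNReal.mul_ne_top ?_ N.maxRate_ne_top
  simp only [networkWeight, Fin.prod_univ_two]
  rw [tsum_finTwo (N.stationWeight 0) (N.stationWeight 1)]
  exact ENNReal.mul_ne_top (hfin 0) (hfin 1)

end Network

theorem ofReal_lt_mul_div_iff {lam a p : ℝ} {m : ℕ} (ha : 0 < a) (hp : 0 ≤ p)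
    (hm : 1 ≤ m) : ENNReal.ofReal lam < ENNReal.ofReal a * ((m : ℝ≥0∞) / ENNReal.ofReal p) ↔
      lam * p < a * m := by
  have hm' : (0 : ℝ) < m := by exact_mod_cast hm
  rcases hp.eq_or_lt with rfl | hp
  · have h1 : (m : ℝ≥0∞) ≠ 0 := by exact_mod_cast (Nat.one_le_iff_ne_zero.1 hm)
    have h2 : 0 < a * m := by positivity
    -- For `p = 0` the quotient is `∞` because `m ≠ 0`, so both sides hold.
    simp [ENNReal.div_zero h1, ENNReal.mul_top, ha, h2]
  · rw [← ENNReal.ofReal_natCast, ← ENNReal.ofReal_div_of_pos hp, ← ENNReal.ofReal_mul ha.le,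
      ENNReal.ofReal_lt_ofReal_iff (by positivity), ← mul_div_assoc, lt_div_iff₀ hp]

end TwoBS
end

theorem mainTheorem8 (lam mu c₁ c₂ p₁ p₂ : ℝ) (m₁ m₂ : ℕ)
    (hlam : 0 < lam) (hmu : 0 < mu) (hc₁ : 0 < c₁) (hc : c₁ < c₂)
    (hp₁ : 0 ≤ p₁) (hp₂ : 0 ≤ p₂) (hp : p₁ + p₂ = 1) (hm₁ : 1 ≤ m₁) (hm₂ : 1 ≤ m₂) :
    TwoBS.Network.Stable
        { lam := lam, mu := mu, c := ![c₁, c₂], p := ![p₁, p₂], m := ![m₁, m₂] }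
        TwoBS.snrPolicy ↔
      ENNReal.ofReal lam < ENNReal.ofReal (mu * c₂) *
        min ((m₁ : ℝ≥0∞) / ENNReal.ofReal p₁) ((m₂ : ℝ≥0∞) / ENNReal.ofReal p₂) := by
  have ha : 0 < mu * c₂ := mul_pos hmu (hc₁.trans hc)
  have hmono : Monotone fun z : ℝ≥0∞ => ENNReal.ofReal (mu * c₂) * z :=
    fun _ _ h => mul_le_mul_right h _
  rw [hmono.map_min, lt_min_iff, TwoBS.ofReal_lt_mul_div_iff ha hp₁ hm₁,
    TwoBS.ofReal_lt_mul_div_iff ha hp₂ hm₂]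
  constructor
  · intro hst
    by_contra hcon
    rw [not_and_or, not_lt, not_lt] at hcon
    rcases hcon with h | h
    · exact TwoBS.Network.not_stable_snrPolicy _ hlam hmu hc₁ hc hp₁ hp₂ hp 0 hm₁ h hst
    · exact TwoBS.Network.not_stable_snrPolicy _ hlam hmu hc₁ hc hp₁ hp₂ hp 1 hm₂ h hst
  · rintro ⟨h1, h2⟩
    exact TwoBS.Network.stable_snrPolicy _ hlam hmu hc₁ hc (Fin.forall_fin_two.2 ⟨hp₁, hp₂⟩) hp
      (Fin.forall_fin_two.2 ⟨hm₁, hm₂⟩) (Fin.forall_fin_two.2 ⟨h1, h2⟩)
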